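/- Let $L>0$ and let $n\ge 1$ be an integer. Put $\lambda_n=n^2\pi^2/L^2$. For $a\in L^1(0,L)$ write $\lambda_n\prec a$ if $\lambda_n\le a(x)$ for almost every $x\in(0,L)$ and $\lambda_n<a(x)$ on a set of positive measure. Let $\Lambda_n$ be the set of all $a\in L^1(0,L)$ with $\lambda_n\prec a$ for which the Neumann problem $$u''(x)+a(x)u(x)=0,\quad x\in(0,L),\qquad u'(0)=u'(L)=0$$ has a nontrivial weak solution, that is, a nonzero $u\in H^1(0,L)$ with $\int_0^L u'v'\,dx=\int_0^L a\,u\,v\,dx$ for all $v\in H^1(0,L)$. Then $\Lambda_n$ is nonempty, $$\beta_{1,n}:=\inf_{a\in\Lambda_n}\|a-\lambda_n\|_{L^1(0,L)}=\frac{2\pi n(n+1)}{L}\cot\frac{\pi n}{2(n+1)},$$ and this infimum is not attained by any $a\in\Lambda_n$. -/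

import Mathlib

open MeasureTheory Set
open scoped ContDiff

noncomputable section

/-- Lebesgue measure on the interval `(0, L)`. -/
abbrev intervalMeasure (L : ℝ) : Measure ℝ := volume.restrict (Ioo 0 L)

/-- `c ≺ d` on `(0, L)`: `c ≤ d` almost everywhere, and `c < d` on a set of positive measure. -/
def Prec (L : ℝ) (c d : ℝ → ℝ) : Prop :=
  (∀ᵐ x ∂(intervalMeasure L), c x ≤ d x) ∧ 0 < intervalMeasure L {x | c x < d x}

/-- `g` is a weak derivative of `u` on `(0, L)`, tested against smooth functions compactly
supported in the open interval. -/
def IsWeakDeriv (L : ℝ) (u g : ℝ → ℝ) : Prop :=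
  ∀ φ : ℝ → ℝ, ContDiff ℝ ∞ φ → HasCompactSupport φ → tsupport φ ⊆ Ioo 0 L →
    ∫ x, u x * deriv φ x ∂(intervalMeasure L) = -∫ x, g x * φ x ∂(intervalMeasure L)

/-- `u` belongs to the Sobolev space `H¹(0, L)`, with weak derivative `g`. -/
structure MemH1With (L : ℝ) (u g : ℝ → ℝ) : Prop where
  memLp : MemLp u 2 (intervalMeasure L)
  memLp_deriv : MemLp g 2 (intervalMeasure L)
  isWeakDeriv : IsWeakDeriv L u g

/-- `u ∈ H¹(0, L)` is a weak solution of the Neumann problem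
`u'' + a u = 0` on `(0, L)`, `u'(0) = u'(L) = 0`. The boundary conditions are the natural ones of
the weak formulation, whose test functions range over all of `H¹(0, L)`. -/
def IsNeumannSolution (L : ℝ) (a u : ℝ → ℝ) : Prop :=
  ∃ u' : ℝ → ℝ, MemH1With L u u' ∧
    ∀ v v' : ℝ → ℝ, MemH1With L v v' →
      ∫ x, u' x * v' x ∂(intervalMeasure L) = ∫ x, a x * u x * v x ∂(intervalMeasure L)

/-- The Neumann problem has a solution that is not zero as an element of `H¹(0, L)`. -/
def HasNontrivialNeumannSolution (L : ℝ) (a : ℝ → ℝ) : Prop :=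
  ∃ u : ℝ → ℝ, IsNeumannSolution L a u ∧ ¬ (u =ᵐ[intervalMeasure L] 0)

/-- The Neumann eigenvalue `λ_n = n² π² / L²`. -/
def neumannEigenvalue (L : ℝ) (n : ℕ) : ℝ := (n : ℝ) ^ 2 * Real.pi ^ 2 / L ^ 2

/-- The set `Λ_n` of `a ∈ L¹(0, L)` with `λ_n ≺ a` for which the Neumann problem has nontrivial
solutions. -/
def LambdaSet (L : ℝ) (n : ℕ) : Set (ℝ → ℝ) :=
  {a | Integrable a (intervalMeasure L) ∧ Prec L (fun _ => neumannEigenvalue L n) a ∧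
    HasNontrivialNeumannSolution L a}

/-- The norm `‖a - λ_n‖` in `L¹(0, L)`. -/
def distL1 (L : ℝ) (n : ℕ) (a : ℝ → ℝ) : ℝ :=
  ∫ x, |a x - neumannEigenvalue L n| ∂(intervalMeasure L)

/-- The constant `β_{1,n}`, the infimum of `‖a - λ_n‖` over `a ∈ Λ_n`. -/
def betaOne (L : ℝ) (n : ℕ) : ℝ := sInf (distL1 L n '' LambdaSet L n)

end

/-!
Write `k = nπ / L`, so that `λ_n = k²`, and `θ₀ = π / (2 (n + 1))`; the constant of the theorem is
`2 k (n + 1) tan θ₀`.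

A weak solution `u` agrees almost everywhere with a function `U` such that `U` and `P = U'` are
absolutely continuous, `P' = -aU`, and `P(0) = P(L) = 0`
(`IsNeumannSolution.exists_hasACDeriv`). Its Prüfer angle, `(kU, -P) = ρ (cos θ, sin θ)`, satisfies
`θ' = k + (a - k²) cos² θ / k`, starts at `θ(0) = 0` and ends at a multiple of `π`
(`exists_prufer_angle`). Since `λ_n ≺ a`, it ends beyond `kL = nπ` (`mul_lt_prufer_angle`), hence
at `(n + 1)π` or later.

The lower bound comes from a calibration. With `w(θ) = min (sec² θ) (sec² θ₀)` one has pointwise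
`(a - k²) / k ≥ w(θ) θ' - k sec² θ₀`. Integrating, the first term on the right contributes at least
`∫ w` over `[0, (n + 1)π]`, which is `(n + 1) (2 tan θ₀ + (π - 2θ₀) sec² θ₀)`; as
`(n + 1) (π - 2θ₀) = kL`, the terms with `sec² θ₀` cancel, and `2 (n + 1) tan θ₀` remains. The
inequality is strict near `x = 0`, where `|θ| < θ₀`, so the infimum is not attained
(`lt_integral_sub_of_prufer_angle`).

For sharpness, any `C¹` angle `θ` with `θ' = k + h`, `h ≥ 0` supported away from the zeros of
`cos θ`, is the Prüfer angle of an explicit potential `a = k² + k h sec² θ`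
(`isNeumannSolution_of_prufer_angle`). Taking `h` periodic of period `L / (n + 1)`, concentrated in
the `δ`-neighbourhoods of the multiples of the period and with mass `2θ₀` in each, gives elements
of `Λ_n` at distance at most `2 k (n + 1) tan (θ₀ + kδ)` from `λ_n`
(`exists_mem_LambdaSet_distL1_le`).
-/

/-! ### Absolutely continuous functions with a prescribed almost everywhere derivative -/

/-- `f` is absolutely continuous on the interval between `a` and `b`, with derivative `f'` almost
everywhere. -/
structure HasACDeriv (f f' : ℝ → ℝ) (a b : ℝ) : Prop where
  ac : AbsolutelyContinuousOnInterval f a b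
  deriv_ae : ∀ᵐ x, x ∈ uIcc a b → HasDerivAt f (f' x) x

namespace HasACDeriv

variable {f g f' g' : ℝ → ℝ} {a b c d : ℝ}

theorem continuousOn (hf : HasACDeriv f f' a b) : ContinuousOn f (uIcc a b) :=
  hf.ac.continuousOn

theorem deriv_ae_eq (hf : HasACDeriv f f' a b) :
    ∀ᵐ x, x ∈ uIoc a b → deriv f x = f' x := by
  filter_upwards [hf.deriv_ae] with x hx hxm
  exact (hx (uIoc_subset_uIcc hxm)).deriv

theorem intervalIntegrable (hf : HasACDeriv f f' a b) : IntervalIntegrable f' volume a b :=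
  hf.ac.intervalIntegrable_deriv.congr_ae
    ((ae_restrict_iff' measurableSet_uIoc).2 hf.deriv_ae_eq)

theorem integral_eq (hf : HasACDeriv f f' a b) : ∫ x in a..b, f' x = f b - f a := by
  rw [← hf.ac.integral_deriv_eq_sub]
  refine intervalIntegral.integral_congr_ae ?_
  filter_upwards [hf.deriv_ae_eq] with x hx hxm using (hx hxm).symm

theorem mono (hf : HasACDeriv f f' a b) (h : uIcc c d ⊆ uIcc a b) : HasACDeriv f f' c d :=
  ⟨hf.ac.mono h, hf.deriv_ae.mono fun _ hx hxm => hx (h hxm)⟩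

theorem congr_deriv (hf : HasACDeriv f f' a b) (h : ∀ᵐ x, x ∈ uIcc a b → f' x = g' x) :
    HasACDeriv f g' a b :=
  ⟨hf.ac, by filter_upwards [hf.deriv_ae, h] with x hx hx' hxm using hx' hxm ▸ hx hxm⟩

theorem const (C : ℝ) : HasACDeriv (fun _ => C) (fun _ => 0) a b :=
  ⟨contDiffOn_const.absolutelyContinuousOnInterval,
    Filter.Eventually.of_forall fun x _ => hasDerivAt_const x C⟩

theorem add (hf : HasACDeriv f f' a b) (hg : HasACDeriv g g' a b) :
    HasACDeriv (fun x => f x + g x) (fun x => f' x + g' x) a b :=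
  ⟨hf.ac.add hg.ac, by
    filter_upwards [hf.deriv_ae, hg.deriv_ae] with x hx hx' hxm using (hx hxm).add (hx' hxm)⟩

theorem neg (hf : HasACDeriv f f' a b) :
    HasACDeriv (fun x => - f x) (fun x => - f' x) a b :=
  ⟨hf.ac.neg, by filter_upwards [hf.deriv_ae] with x hx hxm using (hx hxm).neg⟩

theorem mul (hf : HasACDeriv f f' a b) (hg : HasACDeriv g g' a b) :
    HasACDeriv (fun x => f x * g x) (fun x => f' x * g x + f x * g' x) a b :=
  ⟨hf.ac.mul hg.ac, by
    filter_upwards [hf.deriv_ae, hg.deriv_ae] with x hx hx' hxm using (hx hxm).mul (hx' hxm)⟩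

theorem const_mul (C : ℝ) (hf : HasACDeriv f f' a b) :
    HasACDeriv (fun x => C * f x) (fun x => C * f' x) a b :=
  ⟨hf.ac.const_mul C, by
    filter_upwards [hf.deriv_ae] with x hx hxm using (hx hxm).const_mul C⟩

theorem of_hasDerivAt (h : ∀ x, HasDerivAt f (f' x) x) (hc : Continuous f') :
    HasACDeriv f f' a b := by
  have hd : deriv f = f' := funext fun x => (h x).deriv
  have h1 : ContDiff ℝ 1 f :=
    contDiff_one_iff_deriv.2 ⟨fun x => (h x).differentiableAt, hd ▸ hc⟩
  exact ⟨h1.contDiffOn.absolutelyContinuousOnInterval,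
    Filter.Eventually.of_forall fun x _ => h x⟩

theorem of_integral (h : IntervalIntegrable g volume a b) (hc : c ∈ uIcc a b) :
    HasACDeriv (fun x => ∫ t in c..x, g t) g a b :=
  ⟨h.absolutelyContinuousOnInterval_intervalIntegral hc, by
    filter_upwards [h.ae_hasDerivAt_integral] with x hx hxm using hx hxm c hc⟩

theorem comp {φ φ' : ℝ → ℝ} (hφ : ∀ x, HasDerivAt φ (φ' x) x) (hc : Continuous φ')
    (hf : HasACDeriv f f' a b) :
    HasACDeriv (fun x => φ (f x)) (fun x => φ' (f x) * f' x) a b := by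
  refine ⟨?_, by filter_upwards [hf.deriv_ae] with x hx hxm using (hφ (f x)).comp x (hx hxm)⟩
  obtain ⟨C, hC⟩ := hf.ac.exists_bound
  have hd : deriv φ = φ' := funext fun x => (hφ x).deriv
  have h1 : ContDiff ℝ 1 φ :=
    contDiff_one_iff_deriv.2 ⟨fun x => (hφ x).differentiableAt, hd ▸ hc⟩
  obtain ⟨K, hK⟩ := (h1.contDiffOn (s := Icc (-C) C)).exists_lipschitzOnWith (by decide)
    (convex_Icc _ _) isCompact_Icc
  have hm : ∀ x ∈ uIcc a b, f x ∈ Icc (-C) C := fun x hx => abs_le.1 (hC x hx)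
  have hlim : Filter.Tendsto _ _ _ := Filter.Tendsto.const_mul (K : ℝ) hf.ac
  rw [mul_zero] at hlim
  refine squeeze_zero' (Filter.Eventually.of_forall fun E =>
    Finset.sum_nonneg fun i _ => dist_nonneg) ?_ hlim
  refine Filter.eventually_inf_principal.2 (Filter.Eventually.of_forall fun E hE => ?_)
  rw [Finset.mul_sum]
  exact Finset.sum_le_sum fun i hi =>
    hK.dist_le_mul _ (hm _ (hE.1 i hi).1) _ (hm _ (hE.1 i hi).2)

/-- Integration by parts. -/
theorem integral_mul_eq (hf : HasACDeriv f f' a b) (hg : HasACDeriv g g' a b) :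
    ∫ x in a..b, f x * g' x = f b * g b - f a * g a - ∫ x in a..b, f' x * g x := by
  have h := (hf.mul hg).integral_eq
  rw [intervalIntegral.integral_add (hf.intervalIntegrable.mul_continuousOn hg.continuousOn)
    (hg.intervalIntegrable.continuousOn_mul hf.continuousOn)] at h
  linarith

theorem le_of_deriv_nonneg (hf : HasACDeriv f f' a b) (hab : a ≤ b)
    (h : ∀ᵐ x, x ∈ Icc a b → 0 ≤ f' x) : f a ≤ f b := by
  rw [← sub_nonneg, ← hf.integral_eq]
  refine intervalIntegral.integral_nonneg_of_ae_restrict hab ?_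
  exact (ae_restrict_iff' measurableSet_Icc).2 h

/-- Grönwall's uniqueness principle with an integrable coefficient: a nonnegative `f` with
`|f'| ≤ g f` that vanishes somewhere vanishes identically. -/
theorem eq_zero_of_abs_deriv_le (hf : HasACDeriv f f' a b) (hg : IntervalIntegrable g volume a b)
    (hab : a ≤ b) (hnn : ∀ x ∈ Icc a b, 0 ≤ f x)
    (h : ∀ᵐ x, x ∈ Icc a b → |f' x| ≤ g x * f x) (hc : c ∈ Icc a b) (hfc : f c = 0) :
    ∀ x ∈ Icc a b, f x = 0 := by
  intro x hx
  have hu : uIcc a b = Icc a b := uIcc_of_le hab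
  have hG : HasACDeriv (fun x => ∫ t in a..x, g t) g a b := of_integral hg left_mem_uIcc
  have hE : HasACDeriv _ _ a b := hG.comp Real.hasDerivAt_exp Real.continuous_exp
  have hE' : HasACDeriv _ _ a b := hG.neg.comp Real.hasDerivAt_exp Real.continuous_exp
  refine le_antisymm ?_ (hnn x hx)
  rcases le_total c x with hcx | hxc
  · have hsub : uIcc c x ⊆ uIcc a b := by
      rw [uIcc_of_le hcx, hu]; exact Icc_subset_Icc hc.1 hx.2
    have := ((hf.mul hE').neg.mono hsub).le_of_deriv_nonneg hcx (by
      filter_upwards [h] with y hy hym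
      have h1 := (abs_le.1 (hy ⟨hc.1.trans hym.1, hym.2.trans hx.2⟩)).2
      have h2 := Real.exp_pos (-∫ t in a..y, g t)
      nlinarith)
    simp only [hfc, zero_mul, neg_zero, neg_nonneg] at this
    exact nonpos_of_mul_nonpos_left this (Real.exp_pos _)
  · have hsub : uIcc x c ⊆ uIcc a b := by
      rw [uIcc_of_le hxc, hu]; exact Icc_subset_Icc hx.1 hc.2
    have := ((hf.mul hE).mono hsub).le_of_deriv_nonneg hxc (by
      filter_upwards [h] with y hy hym
      have h1 := (abs_le.1 (hy ⟨hx.1.trans hym.1, hym.2.trans hc.2⟩)).1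
      have h2 := Real.exp_pos (∫ t in a..y, g t)
      nlinarith)
    simp only [hfc, zero_mul] at this
    exact nonpos_of_mul_nonpos_left this (Real.exp_pos _)

end HasACDeriv

/-! ### The truncated squared secant -/

/-- The function `min (sec² t) (sec² θ₀)`, written so that it is visibly continuous. -/
noncomputable def capSecSq (θ₀ t : ℝ) : ℝ := (max (Real.cos t ^ 2) (Real.cos θ₀ ^ 2))⁻¹

section capSecSq

variable {θ₀ : ℝ}

theorem capSecSq_max_pos (h : 0 < Real.cos θ₀) (t : ℝ) :
    0 < max (Real.cos t ^ 2) (Real.cos θ₀ ^ 2) :=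
  lt_max_of_lt_right (by positivity)

theorem continuous_capSecSq (h : 0 < Real.cos θ₀) : Continuous (capSecSq θ₀) :=
  Continuous.inv₀ (by fun_prop) fun t => (capSecSq_max_pos h t).ne'

theorem capSecSq_pos (h : 0 < Real.cos θ₀) (t : ℝ) : 0 < capSecSq θ₀ t :=
  inv_pos.2 (capSecSq_max_pos h t)

theorem capSecSq_mul_cos_sq_le (h : 0 < Real.cos θ₀) (t : ℝ) :
    capSecSq θ₀ t * Real.cos t ^ 2 ≤ 1 := by
  rw [capSecSq, inv_mul_le_iff₀ (capSecSq_max_pos h t), mul_one]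
  exact le_max_left _ _

theorem capSecSq_le (h : 0 < Real.cos θ₀) (t : ℝ) : capSecSq θ₀ t ≤ (Real.cos θ₀ ^ 2)⁻¹ :=
  inv_anti₀ (by positivity) (le_max_right _ _)

theorem capSecSq_periodic : Function.Periodic (capSecSq θ₀) Real.pi := fun t => by
  simp [capSecSq, Real.cos_add_pi]

theorem capSecSq_of_abs_le (h1 : θ₀ < Real.pi / 2) {t : ℝ} (ht : |t| ≤ θ₀) :
    capSecSq θ₀ t = (Real.cos t ^ 2)⁻¹ := by
  have h0 : 0 ≤ θ₀ := (abs_nonneg t).trans ht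
  have hc : Real.cos θ₀ ≤ Real.cos t := by
    rw [← Real.cos_abs t]
    exact Real.cos_le_cos_of_nonneg_of_le_pi (abs_nonneg t) (by linarith) ht
  have hp : 0 < Real.cos θ₀ := Real.cos_pos_of_mem_Ioo ⟨by linarith, h1⟩
  rw [capSecSq, max_eq_left (by gcongr)]

theorem capSecSq_of_mem_Icc (h0 : 0 ≤ θ₀) {t : ℝ}
    (ht : t ∈ Icc θ₀ (Real.pi - θ₀)) : capSecSq θ₀ t = (Real.cos θ₀ ^ 2)⁻¹ := by
  have hc : |Real.cos t| ≤ Real.cos θ₀ := by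
    rw [abs_le]
    constructor
    · rw [← Real.cos_pi_sub θ₀]
      exact Real.cos_le_cos_of_nonneg_of_le_pi (h0.trans ht.1) (by linarith) ht.2
    · exact Real.cos_le_cos_of_nonneg_of_le_pi h0 (by linarith [ht.2]) ht.1
  rw [capSecSq, max_eq_right]
  rw [← sq_abs (Real.cos t)]
  gcongr

theorem integral_capSecSq_symm (h1 : θ₀ < Real.pi / 2) (h0 : 0 ≤ θ₀) :
    ∫ t in (-θ₀)..θ₀, capSecSq θ₀ t = 2 * Real.tan θ₀ := by
  have hp : 0 < Real.cos θ₀ := Real.cos_pos_of_mem_Ioo ⟨by linarith, h1⟩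
  have hu : uIcc (-θ₀) θ₀ = Icc (-θ₀) θ₀ := uIcc_of_le (by linarith)
  rw [intervalIntegral.integral_eq_sub_of_hasDerivAt (f := Real.tan)
    (fun t ht => ?_) ((continuous_capSecSq hp).intervalIntegrable _ _), Real.tan_neg]
  · ring
  · rw [hu] at ht
    rw [capSecSq_of_abs_le h1 (abs_le.2 ht), ← one_div]
    exact Real.hasDerivAt_tan (Real.cos_pos_of_mem_Ioo
      ⟨by linarith [ht.1], by linarith [ht.2]⟩).ne'

theorem integral_capSecSq_nat_mul_pi (h1 : θ₀ < Real.pi / 2) (h0 : 0 ≤ θ₀) (N : ℕ) :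
    ∫ t in (0 : ℝ)..(N * Real.pi), capSecSq θ₀ t =
      N * (2 * Real.tan θ₀ + (Real.pi - 2 * θ₀) * (Real.cos θ₀ ^ 2)⁻¹) := by
  have hp : 0 < Real.cos θ₀ := Real.cos_pos_of_mem_Ioo ⟨by linarith, h1⟩
  have hi : ∀ a b, IntervalIntegrable (capSecSq θ₀) volume a b :=
    fun a b => (continuous_capSecSq hp).intervalIntegrable a b
  have hN := (capSecSq_periodic (θ₀ := θ₀)).intervalIntegral_add_zsmul_eq N 0 hi
  have h2 : ∫ t in θ₀..(Real.pi - θ₀), capSecSq θ₀ t =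
      (Real.pi - 2 * θ₀) * (Real.cos θ₀ ^ 2)⁻¹ := by
    rw [intervalIntegral.integral_congr (g := fun _ => (Real.cos θ₀ ^ 2)⁻¹) fun t ht => ?_]
    · simp only [intervalIntegral.integral_const, smul_eq_mul]; ring
    · rw [uIcc_of_le (by linarith)] at ht
      exact capSecSq_of_mem_Icc h0 ht
  have h3 : ∫ t in (0 : ℝ)..(0 + Real.pi), capSecSq θ₀ t =
      2 * Real.tan θ₀ + (Real.pi - 2 * θ₀) * (Real.cos θ₀ ^ 2)⁻¹ := by
    rw [capSecSq_periodic.intervalIntegral_add_eq 0 (-θ₀), ← integral_capSecSq_symm h1 h0, ← h2,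
      intervalIntegral.integral_add_adjacent_intervals (hi _ _) (hi _ _)]
    congr 1; ring
  simp only [zsmul_eq_mul, Int.cast_natCast, zero_add] at hN h3
  rw [hN, h3]

end capSecSq

/-! ### The Prüfer angle -/

/-- A nontrivial pair `(U, P)` with `U' = P`, `P' = -aU` has a Prüfer angle `θ`: in polar
coordinates `(kU, -P) = ρ (cos θ, sin θ)`. -/
theorem exists_prufer_angle {a U P : ℝ → ℝ} {k L : ℝ} (hk : 0 < k) (hL : 0 < L)
    (ha : IntervalIntegrable a volume 0 L)
    (hU : HasACDeriv U P 0 L) (hP : HasACDeriv P (fun x => -(a x * U x)) 0 L)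
    (hP0 : P 0 = 0) (hPL : P L = 0) (hne : ∃ x ∈ Icc 0 L, U x ≠ 0) :
    ∃ θ : ℝ → ℝ, HasACDeriv θ (fun x => k + (a x - k ^ 2) * Real.cos (θ x) ^ 2 / k) 0 L ∧
      θ 0 = 0 ∧ Real.sin (θ L) = 0 := by
  have hu : uIcc 0 L = Icc 0 L := uIcc_of_le hL.le
  set D : ℝ → ℝ := fun x => k ^ 2 * (U x * U x) + P x * P x with hD
  have hDnn : ∀ x, 0 ≤ D x := fun x =>
    add_nonneg (mul_nonneg (sq_nonneg k) (mul_self_nonneg _)) (mul_self_nonneg _)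
  have hDd := ((hU.mul hU).const_mul (k ^ 2)).add (hP.mul hP)
  have hg : IntervalIntegrable (fun x => |k ^ 2 - a x| / k) volume 0 L :=
    ((intervalIntegrable_const.sub ha).abs).div_const k
  have key : ∀ u p : ℝ, 2 * |u| * |p| ≤ (k ^ 2 * (u * u) + p * p) / k := fun u p => by
    rw [le_div_iff₀ hk]
    nlinarith [sq_nonneg (k * |u| - |p|), abs_mul_abs_self u, abs_mul_abs_self p]
  -- `k²U² + P²` has no zero, by uniqueness.
  have hDne : ∀ x ∈ Icc 0 L, D x ≠ 0 := by
    intro c hc hDc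
    obtain ⟨x, hx, hUx⟩ := hne
    have := hDd.eq_zero_of_abs_deriv_le hg hL.le (fun x _ => hDnn x)
      (Filter.Eventually.of_forall fun x _ => ?_) hc hDc x hx
    · have h1 : 0 < k ^ 2 * (U x * U x) := mul_pos (by positivity) (mul_self_pos.2 hUx)
      nlinarith [mul_self_nonneg (P x)]
    · calc _ = |(k ^ 2 - a x) * (2 * U x * P x)| := by congr 1; ring
        _ = |k ^ 2 - a x| * (2 * |U x| * |P x|) := by rw [abs_mul, abs_mul, abs_mul, abs_two]
        _ ≤ |k ^ 2 - a x| * ((k ^ 2 * (U x * U x) + P x * P x) / k) := by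
            gcongr; exact key _ _
        _ = _ := by ring
  have hDpos : ∀ x ∈ Icc 0 L, 0 < D x := fun x hx =>
    lt_of_le_of_ne (hDnn x) (hDne x hx).symm
  have hDc : ContinuousOn (fun x => (D x)⁻¹) (uIcc 0 L) :=
    ContinuousOn.inv₀ hDd.continuousOn (hu ▸ hDne)
  have hθi : IntervalIntegrable (fun x => k * (a x * (U x * U x) + P x * P x) * (D x)⁻¹)
      volume 0 L := by
    refine IntervalIntegrable.mul_continuousOn (IntervalIntegrable.const_mul
      (IntervalIntegrable.add ?_ ?_) k) hDc
    · exact ha.mul_continuousOn (hU.continuousOn.mul hU.continuousOn)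
    · exact (hP.continuousOn.mul hP.continuousOn).intervalIntegrable
  have hθ := HasACDeriv.of_integral hθi (left_mem_uIcc (a := 0))
  set θ : ℝ → ℝ := fun x => ∫ t in (0 : ℝ)..x, k * (a t * (U t * U t) + P t * P t) * (D t)⁻¹
  have hθ0 : θ 0 = 0 := intervalIntegral.integral_same
  have hs : HasACDeriv (fun x => Real.sin (θ x)) _ 0 L :=
    hθ.comp Real.hasDerivAt_sin Real.continuous_cos
  have hcs : HasACDeriv (fun x => Real.cos (θ x)) _ 0 L :=
    hθ.comp Real.hasDerivAt_cos Real.continuous_sin.neg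
  -- The component of `(kU, -P)` orthogonal to `(cos θ, sin θ)` solves a linear equation.
  have hA := ((hU.const_mul k).mul hs).add (hP.mul hcs)
  have hA0 : ∀ x ∈ Icc 0 L, k * U x * Real.sin (θ x) + P x * Real.cos (θ x) = 0 := by
    intro x hx
    have := (hA.mul hA).eq_zero_of_abs_deriv_le hg hL.le (fun x _ => mul_self_nonneg _)
      (Filter.Eventually.of_forall fun x hx => ?_) (left_mem_Icc.2 hL.le)
      (by simp [hθ0, hP0]) x hx
    · exact mul_self_eq_zero.1 this
    · have hd := hDne x hx
      have hpos := hDpos x hx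
      have h2 : k ^ 2 * (U x * U x) + P x * P x ≠ 0 := hd
      set A := k * U x * Real.sin (θ x) + P x * Real.cos (θ x) with hAdef
      calc _ = |(k ^ 2 - a x) * (2 * U x * P x) * (D x)⁻¹ * (A * A)| := by
            congr 1
            have hinv : (k ^ 2 * (U x * U x) + P x * P x) * (D x)⁻¹ = 1 := mul_inv_cancel₀ h2
            linear_combination (-(2 * A * (k * P x * Real.sin (θ x) -
              a x * U x * Real.cos (θ x)))) * hinv
        _ = |k ^ 2 - a x| * (2 * |U x| * |P x|) * (D x)⁻¹ * (A * A) := by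
            rw [abs_mul, abs_mul, abs_mul, abs_mul, abs_mul, abs_two, abs_inv,
              abs_of_pos hpos, abs_of_nonneg (mul_self_nonneg A)]
        _ ≤ |k ^ 2 - a x| * (D x / k) * (D x)⁻¹ * (A * A) := by
            gcongr
            · exact mul_self_nonneg A
            · exact key _ _
        _ = _ := by field_simp
  refine ⟨θ, hθ.congr_deriv (Filter.Eventually.of_forall fun x hx => ?_), hθ0, ?_⟩
  · rw [hu] at hx
    have hd : k ^ 2 * (U x * U x) + P x * P x ≠ 0 := hDne x hx
    have h1 := hA0 x hx
    have h2 : k * U x * Real.sin (θ x) = -(P x * Real.cos (θ x)) := by linarith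
    have h3 : k ^ 2 * (U x * U x) =
        (k ^ 2 * (U x * U x) + P x * P x) * Real.cos (θ x) ^ 2 := by
      have h4 : (k * U x * Real.sin (θ x)) ^ 2 = (P x * Real.cos (θ x)) ^ 2 := by
        rw [h2]; ring
      have := Real.sin_sq_add_cos_sq (θ x)
      linear_combination (-(k ^ 2 * (U x * U x))) * this + h4
    simp only [hD]
    rw [← div_eq_mul_inv, div_eq_iff hd, add_mul]
    have h5 : (a x - k ^ 2) * Real.cos (θ x) ^ 2 / k * (k ^ 2 * (U x * U x) + P x * P x) =
        (a x - k ^ 2) / k * (k ^ 2 * (U x * U x)) := by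
      linear_combination (-(a x - k ^ 2) / k) * h3
    rw [h5]
    field_simp
    ring
  · have h1 := hA0 L (right_mem_Icc.2 hL.le)
    have h2 := hDne L (right_mem_Icc.2 hL.le)
    simp only [hD, hPL] at h1 h2
    have hUL : U L ≠ 0 := fun h => h2 (by simp [h])
    simpa [hk.ne', hUL] using h1

/-! ### The strict lower bound -/

section LowerBound

variable {a θ : ℝ → ℝ} {k L : ℝ}

/-- The Prüfer angle advances by more than `kL`: otherwise `cos θ` would vanish on the set of
positive measure where `k² < a`, but `θ` is strictly increasing. -/
theorem mul_lt_prufer_angle (hk : 0 < k) (hL : 0 < L)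
    (hle : ∀ᵐ x, x ∈ Icc 0 L → k ^ 2 ≤ a x)
    (hpos : 0 < volume (Ioc 0 L ∩ {x | k ^ 2 < a x}))
    (hθ : HasACDeriv θ (fun x => k + (a x - k ^ 2) * Real.cos (θ x) ^ 2 / k) 0 L)
    (hθ0 : θ 0 = 0) : k * L < θ L := by
  have hu : uIcc 0 L = Icc 0 L := uIcc_of_le hL.le
  have hlin : HasACDeriv (fun x => -(k * x)) (fun _ => -(k * 1)) 0 L :=
    HasACDeriv.of_hasDerivAt (fun x => ((hasDerivAt_id x).const_mul k).neg) continuous_const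
  have hψ := hθ.add hlin
  have hψ' : ∀ᵐ x, x ∈ Icc 0 L →
      0 ≤ k + (a x - k ^ 2) * Real.cos (θ x) ^ 2 / k + -(k * 1) := by
    filter_upwards [hle] with x hx hxm
    have h1 : 0 ≤ a x - k ^ 2 := sub_nonneg.2 (hx hxm)
    have : 0 ≤ (a x - k ^ 2) * Real.cos (θ x) ^ 2 / k := by positivity
    linarith
  have hmono : StrictMonoOn θ (Icc 0 L) := by
    intro x hx y hy hxy
    have hsub : uIcc x y ⊆ uIcc 0 L := by
      rw [uIcc_of_le hxy.le, hu]; exact Icc_subset_Icc hx.1 hy.2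
    have := (hψ.mono hsub).le_of_deriv_nonneg hxy.le
      (hψ'.mono fun z hz hzm => hz ⟨hx.1.trans hzm.1, hzm.2.trans hy.2⟩)
    nlinarith
  have hcount : (Icc 0 L ∩ {x | Real.cos (θ x) = 0}).Countable := by
    have : Icc 0 L ∩ {x | Real.cos (θ x) = 0} ⊆
        ⋃ m : ℤ, Icc 0 L ∩ {x | θ x = (2 * m + 1) * Real.pi / 2} := by
      rintro x ⟨hx, hc⟩
      obtain ⟨m, hm⟩ := Real.cos_eq_zero_iff.1 hc
      exact mem_iUnion.2 ⟨m, hx, hm⟩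
    refine (countable_iUnion fun m => ?_).mono this
    refine Subsingleton.countable ?_
    rintro x ⟨hx, hx'⟩ y ⟨hy, hy'⟩
    exact hmono.injOn hx hy (hx'.trans hy'.symm)
  have hint : 0 < ∫ x in (0 : ℝ)..L, (k + (a x - k ^ 2) * Real.cos (θ x) ^ 2 / k + -(k * 1)) := by
    rw [intervalIntegral.integral_pos_iff_support_of_nonneg_ae' ?_ hψ.intervalIntegrable]
    · refine ⟨hL, ?_⟩
      have hdiff : volume ((Ioc 0 L ∩ {x | k ^ 2 < a x}) \ (Icc 0 L ∩ {x | Real.cos (θ x) = 0})) =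
          volume (Ioc 0 L ∩ {x | k ^ 2 < a x}) := measure_sdiff_null (hcount.measure_zero _)
      rw [← hdiff] at hpos
      refine hpos.trans_le (measure_mono ?_)
      rintro x ⟨⟨hx, hax⟩, hc⟩
      refine ⟨?_, hx⟩
      have h1 : 0 < a x - k ^ 2 := sub_pos.2 hax
      have h2 : Real.cos (θ x) ≠ 0 := fun h => hc ⟨Ioc_subset_Icc_self hx, h⟩
      have : 0 < (a x - k ^ 2) * Real.cos (θ x) ^ 2 / k := by positivity
      simp only [Function.mem_support]
      linarith
    · refine (ae_restrict_iff' measurableSet_uIoc).2 (hψ'.mono fun x hx hxm => ?_)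
      rw [uIoc_of_le hL.le] at hxm
      exact hx (Ioc_subset_Icc_self hxm)
  rw [hψ.integral_eq, hθ0] at hint
  linarith

/-- The calibration argument: `(a - k²)/k ≥ w(θ) θ' - k / cos² θ₀` for `w = capSecSq θ₀`, and the
right-hand side integrates to the extremal value. The inequality is strict near `x = 0`, where
`|θ| < θ₀`. -/
theorem lt_integral_sub_of_prufer_angle {n : ℕ} (hn : 1 ≤ n) (hk : 0 < k) (hL : 0 < L)
    (hkL : k * L = n * Real.pi) (ha : IntervalIntegrable a volume 0 L)
    (hle : ∀ᵐ x, x ∈ Icc 0 L → k ^ 2 ≤ a x)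
    (hpos : 0 < volume (Ioc 0 L ∩ {x | k ^ 2 < a x}))
    (hθ : HasACDeriv θ (fun x => k + (a x - k ^ 2) * Real.cos (θ x) ^ 2 / k) 0 L)
    (hθ0 : θ 0 = 0) (hθL : Real.sin (θ L) = 0) :
    2 * k * (n + 1) * Real.tan (Real.pi / (2 * (n + 1))) <
      ∫ x in (0 : ℝ)..L, (a x - k ^ 2) := by
  have hu : uIcc 0 L = Icc 0 L := uIcc_of_le hL.le
  have hn' : (1 : ℝ) ≤ n := by exact_mod_cast hn
  set θ₀ := Real.pi / (2 * (n + 1)) with hθ₀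
  have hθ₀pos : 0 < θ₀ := by positivity
  have hθ₀mul : 2 * (n + 1) * θ₀ = Real.pi := by rw [hθ₀]; field_simp
  have hθ₀lt : θ₀ < Real.pi / 2 := by nlinarith
  have hc : 0 < Real.cos θ₀ := Real.cos_pos_of_mem_Ioo ⟨by linarith, hθ₀lt⟩
  have hwc := continuous_capSecSq hc
  have hend : (n + 1 : ℕ) * Real.pi ≤ θ L := by
    have h1 := mul_lt_prufer_angle hk hL hle hpos hθ hθ0
    obtain ⟨m, hm⟩ := Real.sin_eq_zero_iff.1 hθL
    rw [hkL, ← hm] at h1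
    have h2 : (n : ℝ) < m := lt_of_mul_lt_mul_right h1 Real.pi_pos.le
    have h3 : (n : ℤ) < m := by exact_mod_cast h2
    have h4 : (((n + 1 : ℕ) : ℤ) : ℝ) ≤ m := by exact_mod_cast h3
    rw [← hm]
    exact mul_le_mul_of_nonneg_right (by exact_mod_cast h4) Real.pi_pos.le
  -- The potential `W = ∫ w`, evaluated along the Prüfer angle.
  have hW : ∀ t, HasDerivAt (fun t => ∫ s in (0 : ℝ)..t, capSecSq θ₀ s) (capSecSq θ₀ t) t :=
    fun t => intervalIntegral.integral_hasDerivAt_right (hwc.intervalIntegrable _ _)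
      hwc.stronglyMeasurable.stronglyMeasurableAtFilter hwc.continuousAt
  have hWθ := hθ.comp hW hwc
  have hval : (n + 1 : ℕ) * (2 * Real.tan θ₀ + (Real.pi - 2 * θ₀) * (Real.cos θ₀ ^ 2)⁻¹) ≤
      ∫ x in (0 : ℝ)..L, capSecSq θ₀ (θ x) * (k + (a x - k ^ 2) * Real.cos (θ x) ^ 2 / k) := by
    rw [hWθ.integral_eq, hθ0, intervalIntegral.integral_same, sub_zero,
      ← integral_capSecSq_nat_mul_pi hθ₀lt hθ₀pos.le]
    have := intervalIntegral.integral_interval_sub_left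
      (hwc.intervalIntegrable (μ := volume) 0 (θ L))
      (hwc.intervalIntegrable (μ := volume) 0 ((n + 1 : ℕ) * Real.pi))
    have h2 : 0 ≤ ∫ s in ((n + 1 : ℕ) * Real.pi)..(θ L), capSecSq θ₀ s :=
      intervalIntegral.integral_nonneg hend fun t _ => (capSecSq_pos hc t).le
    linarith
  have hgap : 0 < ∫ x in (0 : ℝ)..L, ((Real.cos θ₀ ^ 2)⁻¹ - capSecSq θ₀ (θ x)) := by
    refine intervalIntegral.integral_pos hL
      (continuousOn_const.sub (hwc.comp_continuousOn (hu ▸ hθ.continuousOn)))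
      (fun x _ => sub_nonneg.2 (capSecSq_le hc _)) ⟨0, left_mem_Icc.2 hL.le, ?_⟩
    have h1 : Real.cos θ₀ < 1 := by
      rw [← Real.cos_zero]
      exact Real.cos_lt_cos_of_nonneg_of_le_pi le_rfl (by linarith) hθ₀pos
    rw [hθ0, capSecSq_of_abs_le hθ₀lt (by simpa using hθ₀pos.le), Real.cos_zero, one_pow, inv_one,
      sub_pos]
    exact (one_lt_inv₀ (by positivity)).2 (by nlinarith)
  have hgi : IntervalIntegrable (fun x => (Real.cos θ₀ ^ 2)⁻¹ - capSecSq θ₀ (θ x)) volume 0 L :=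
    (continuousOn_const.sub (hwc.comp_continuousOn hθ.continuousOn)).intervalIntegrable
  have hai : IntervalIntegrable (fun x => a x - k ^ 2) volume 0 L :=
    ha.sub intervalIntegrable_const
  have hsum : (∫ x in (0 : ℝ)..L,
        capSecSq θ₀ (θ x) * (k + (a x - k ^ 2) * Real.cos (θ x) ^ 2 / k)) +
      k * ∫ x in (0 : ℝ)..L, ((Real.cos θ₀ ^ 2)⁻¹ - capSecSq θ₀ (θ x)) ≤
      k * (Real.cos θ₀ ^ 2)⁻¹ * L + (∫ x in (0 : ℝ)..L, (a x - k ^ 2)) / k := by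
    have hconst : k * (Real.cos θ₀ ^ 2)⁻¹ * L =
        ∫ x in (0 : ℝ)..L, k * (Real.cos θ₀ ^ 2)⁻¹ := by
      simp only [intervalIntegral.integral_const, smul_eq_mul]; ring
    rw [hconst, ← intervalIntegral.integral_div, ← intervalIntegral.integral_const_mul,
      ← intervalIntegral.integral_add hWθ.intervalIntegrable (hgi.const_mul k),
      ← intervalIntegral.integral_add intervalIntegrable_const (hai.div_const k)]
    refine intervalIntegral.integral_mono_ae_restrict hL.le
      (hWθ.intervalIntegrable.add (hgi.const_mul k))
      (intervalIntegrable_const.add (hai.div_const k)) ?_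
    refine (ae_restrict_iff' measurableSet_Icc).2 (hle.mono fun x hx hxm => ?_)
    have h1 : 0 ≤ (a x - k ^ 2) / k := div_nonneg (sub_nonneg.2 (hx hxm)) hk.le
    have h2 := mul_le_mul_of_nonneg_left (capSecSq_mul_cos_sq_le hc (θ x)) h1
    have h3 : capSecSq θ₀ (θ x) * (k + (a x - k ^ 2) * Real.cos (θ x) ^ 2 / k) =
        k * capSecSq θ₀ (θ x) +
          (a x - k ^ 2) / k * (capSecSq θ₀ (θ x) * Real.cos (θ x) ^ 2) := by ring
    simp only [h3]
    linarith
  push_cast at hval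
  have h1 : (n + 1) * (Real.pi - 2 * θ₀) = k * L := by rw [hkL]; linarith
  have h2 : (n + 1) * (2 * Real.tan θ₀) < (∫ x in (0 : ℝ)..L, (a x - k ^ 2)) / k := by
    have h3 := mul_pos hk hgap
    have h4 : (n + 1) * ((Real.pi - 2 * θ₀) * (Real.cos θ₀ ^ 2)⁻¹) =
      k * (Real.cos θ₀ ^ 2)⁻¹ * L := by rw [← mul_assoc, h1]; ring
    linarith
  rw [lt_div_iff₀ hk] at h2
  linarith

end LowerBound

/-! ### Weak derivatives on an interval -/

section Sobolev

variable {L : ℝ}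

theorem integral_intervalMeasure (hL : 0 ≤ L) (f : ℝ → ℝ) :
    ∫ x, f x ∂(intervalMeasure L) = ∫ x in (0 : ℝ)..L, f x := by
  rw [intervalIntegral.integral_of_le hL, integral_Ioc_eq_integral_Ioo]

theorem intervalIntegrable_iff_intervalMeasure (hL : 0 ≤ L) {f : ℝ → ℝ} :
    IntervalIntegrable f volume 0 L ↔ Integrable f (intervalMeasure L) := by
  rw [intervalIntegrable_iff_integrableOn_Ioo_of_le hL, IntegrableOn]

theorem ae_intervalMeasure_iff (hL : 0 ≤ L) {p : ℝ → Prop} :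
    (∀ᵐ x ∂(intervalMeasure L), p x) ↔ ∀ᵐ x, x ∈ uIcc 0 L → p x := by
  rw [uIcc_of_le hL, ← ae_restrict_iff' measurableSet_Icc, intervalMeasure,
    Measure.restrict_congr_set Ioo_ae_eq_Icc]

/-- The du Bois-Reymond lemma: a function orthogonal to all derivatives of test functions is
almost everywhere constant. -/
theorem exists_ae_eq_const_of_integral_mul_deriv_eq_zero (hL : 0 < L) {w : ℝ → ℝ}
    (hw : Integrable w (intervalMeasure L))
    (h : ∀ φ : ℝ → ℝ, ContDiff ℝ ∞ φ → HasCompactSupport φ → tsupport φ ⊆ Ioo 0 L →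
      ∫ x, w x * deriv φ x ∂(intervalMeasure L) = 0) :
    ∃ c, ∀ᵐ x ∂(intervalMeasure L), w x = c := by
  -- A test function of integral one, used to correct an arbitrary test function to mean zero.
  obtain ⟨η, hηs, hηc, hηt, hηi⟩ : ∃ η : ℝ → ℝ, ContDiff ℝ ∞ η ∧ HasCompactSupport η ∧
      tsupport η ⊆ Ioo 0 L ∧ ∫ x, η x = 1 := by
    let b : ContDiffBump (L / 2) := ⟨L / 8, L / 4, by positivity, by linarith⟩
    refine ⟨b.normed volume, b.contDiff_normed, b.hasCompactSupport_normed, ?_, b.integral_normed⟩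
    rw [b.tsupport_normed_eq, Real.closedBall_eq_Icc]
    exact Icc_subset_Ioo (by simp only [b]; linarith) (by simp only [b]; linarith)
  -- A test function of mean zero is the derivative of a test function.
  have hprim : ∀ ψ : ℝ → ℝ, ContDiff ℝ ∞ ψ → HasCompactSupport ψ → tsupport ψ ⊆ Ioo 0 L →
      ∫ x, ψ x = 0 → ∫ x, w x * ψ x ∂(intervalMeasure L) = 0 := by
    intro ψ hψs hψc hψt hψi
    rcases (tsupport ψ).eq_empty_or_nonempty with hemp | hne
    · simp [tsupport_eq_empty_iff.1 hemp]
    have hα := hψt (hψc.isCompact.sInf_mem hne)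
    have hβ := hψt (hψc.isCompact.sSup_mem hne)
    have hsub : tsupport ψ ⊆ Icc (sInf (tsupport ψ)) (sSup (tsupport ψ)) :=
      hψc.isCompact.isBounded.subset_Icc_sInf_sSup
    set α := sInf (tsupport ψ)
    set β := sSup (tsupport ψ)
    have hd : ∀ x, HasDerivAt (fun x => ∫ t in (0 : ℝ)..x, ψ t) (ψ x) x := fun x =>
      intervalIntegral.integral_hasDerivAt_right (hψs.continuous.intervalIntegrable _ _)
        hψs.continuous.stronglyMeasurable.stronglyMeasurableAtFilter hψs.continuous.continuousAt
    have hderiv : deriv (fun x => ∫ t in (0 : ℝ)..x, ψ t) = ψ := funext fun x => (hd x).deriv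
    have hsupp : tsupport (fun x => ∫ t in (0 : ℝ)..x, ψ t) ⊆ Icc α β := by
      refine closure_minimal (fun x hx => ?_) isClosed_Icc
      by_contra hxm
      refine hx ?_
      rcases lt_or_ge x α with hxα | hxα
      · refine intervalIntegral.integral_zero_ae (Filter.Eventually.of_forall fun t ht => ?_)
        refine image_eq_zero_of_notMem_tsupport fun htm => ?_
        exact absurd (hsub htm).1 (not_le.2 (ht.2.trans_lt (max_lt hα.1 hxα)))
      · have hxβ : β < x := by
          by_contra hh
          exact hxm ⟨hxα, not_lt.1 hh⟩
        simp only
        rw [intervalIntegral.integral_eq_integral_of_support_subset, hψi]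
        intro t ht
        have := subset_tsupport ψ ht
        exact ⟨(hψt this).1, (hsub this).2.trans hxβ.le⟩
    have := h (fun x => ∫ t in (0 : ℝ)..x, ψ t)
      (contDiff_infty_iff_deriv.2 ⟨fun x => (hd x).differentiableAt, by rwa [hderiv]⟩)
      (isCompact_Icc.of_isClosed_subset (isClosed_tsupport _) hsupp)
      (hsupp.trans (Icc_subset_Ioo hα.1 hβ.2))
    rwa [hderiv] at this
  refine ⟨∫ x, w x * η x ∂(intervalMeasure L), ?_⟩
  set c := ∫ x, w x * η x ∂(intervalMeasure L)
  have hwi : ∀ ψ : ℝ → ℝ, ContDiff ℝ ∞ ψ → HasCompactSupport ψ →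
      Integrable (fun x => w x * ψ x) (intervalMeasure L) := by
    intro ψ hψs hψc
    obtain ⟨C, hC⟩ := hψs.continuous.bounded_above_of_compact_support hψc
    exact hw.mul_bdd hψs.continuous.aestronglyMeasurable (Filter.Eventually.of_forall hC)
  have hout : ∀ ψ : ℝ → ℝ, tsupport ψ ⊆ Ioo 0 L →
      ∫ x, ψ x ∂(intervalMeasure L) = ∫ x, ψ x := fun ψ hψt =>
    setIntegral_eq_integral_of_forall_compl_eq_zero fun x hx =>
      image_eq_zero_of_notMem_tsupport fun hx' => hx (hψt hx')
  have key := isOpen_Ioo.ae_eq_zero_of_integral_contDiff_smul_eq_zero (U := Ioo 0 L)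
    (f := (Ioo 0 L).indicator fun x => w x - c) (μ := volume) ?_ ?_
  · refine (ae_restrict_iff' measurableSet_Ioo).2 (key.mono fun x hx hxm => ?_)
    have := hx hxm
    rw [indicator_of_mem hxm] at this
    linarith
  · refine IntegrableOn.locallyIntegrableOn ?_
    refine Integrable.integrableOn ?_
    exact (integrable_indicator_iff measurableSet_Ioo).2 (hw.sub (integrable_const c))
  · intro ψ hψs hψc hψt
    have hψi : Integrable ψ (intervalMeasure L) :=
      (hψs.continuous.integrable_of_hasCompactSupport hψc).integrableOn
    have h0 := hprim (fun x => ψ x - (∫ y, ψ y) * η x) (hψs.sub (contDiff_const.mul hηs))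
      (hψc.sub (hηc.mul_left)) ?_ ?_
    · have h1 : ∫ x, ψ x • (Ioo 0 L).indicator (fun x => w x - c) x =
          ∫ x, (w x * ψ x - c * ψ x) ∂(intervalMeasure L) := by
        rw [← integral_indicator measurableSet_Ioo]
        congr 1; ext x
        by_cases hx : x ∈ Ioo 0 L
        · simp only [indicator_of_mem hx, smul_eq_mul]; ring
        · simp [indicator_of_notMem hx]
      rw [h1, integral_sub (hwi ψ hψs hψc) (hψi.const_mul c), integral_const_mul, hout ψ hψt]
      have h2 : ∀ x, w x * (ψ x - (∫ y, ψ y) * η x) = w x * ψ x - (∫ y, ψ y) * (w x * η x) :=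
        fun x => by ring
      simp only [h2] at h0
      rw [integral_sub (hwi ψ hψs hψc) ((hwi η hηs hηc).const_mul _), integral_const_mul] at h0
      linarith
    · refine (tsupport_sub _ _).trans (union_subset hψt ((tsupport_mul_subset_right).trans hηt))
    · rw [integral_sub (hψs.continuous.integrable_of_hasCompactSupport hψc)
        ((hηs.continuous.integrable_of_hasCompactSupport hηc).const_mul _), integral_const_mul, hηi]
      ring

/-- A function in `H¹(0, L)` has an absolutely continuous representative. -/
theorem MemH1With.exists_hasACDeriv (hL : 0 < L) {u g : ℝ → ℝ} (h : MemH1With L u g) :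
    ∃ U : ℝ → ℝ, HasACDeriv U g 0 L ∧ ∀ᵐ x ∂(intervalMeasure L), u x = U x := by
  have hui : Integrable u (intervalMeasure L) := h.memLp.integrable (by norm_num)
  have hgi : IntervalIntegrable g volume 0 L :=
    (intervalIntegrable_iff_intervalMeasure hL.le).2 (h.memLp_deriv.integrable (by norm_num))
  have hG := HasACDeriv.of_integral hgi (left_mem_uIcc (a := 0))
  have hGi : Integrable (fun x => ∫ t in (0 : ℝ)..x, g t) (intervalMeasure L) :=
    (intervalIntegrable_iff_intervalMeasure hL.le).1 hG.continuousOn.intervalIntegrable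
  obtain ⟨c, hc⟩ := exists_ae_eq_const_of_integral_mul_deriv_eq_zero hL (hui.sub hGi) (by
    intro φ hφs hφc hφt
    have hφd : HasACDeriv φ (deriv φ) 0 L := HasACDeriv.of_hasDerivAt
      (fun x => (hφs.differentiable (by simp) x).hasDerivAt) (hφs.continuous_deriv (by simp))
    have hφ0 : φ 0 = 0 := image_eq_zero_of_notMem_tsupport fun hx => (hφt hx).1.ne rfl
    have hφL : φ L = 0 := image_eq_zero_of_notMem_tsupport fun hx => (hφt hx).2.ne rfl
    have hb : ∀ f : ℝ → ℝ, Integrable f (intervalMeasure L) →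
        Integrable (fun x => f x * deriv φ x) (intervalMeasure L) := by
      intro f hf
      obtain ⟨C, hC⟩ := (hφs.continuous_deriv (by simp)).bounded_above_of_compact_support hφc.deriv
      exact hf.mul_bdd (hφs.continuous_deriv (by simp)).aestronglyMeasurable
        (Filter.Eventually.of_forall hC)
    simp only [Pi.sub_apply, sub_mul]
    rw [integral_sub (hb u hui) (hb _ hGi), h.isWeakDeriv φ hφs hφc hφt,
      integral_intervalMeasure hL.le, integral_intervalMeasure hL.le, hG.integral_mul_eq hφd,
      hφ0, hφL]
    ring)
  refine ⟨fun x => (∫ t in (0 : ℝ)..x, g t) + c, ?_, hc.mono fun x hx => ?_⟩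
  · simpa using hG.add (HasACDeriv.const c)
  · simp only [Pi.sub_apply] at hx
    linarith

/-- Continuously differentiable functions are in `H¹(0, L)`, with their classical derivative. -/
theorem MemH1With.of_hasDerivAt (hL : 0 < L) {v v' : ℝ → ℝ} (h : ∀ x, HasDerivAt v (v' x) x)
    (hc : Continuous v') : MemH1With L v v' := by
  have hLp : ∀ f : ℝ → ℝ, Continuous f → MemLp f 2 (intervalMeasure L) := by
    intro f hf
    obtain ⟨C, hC⟩ := isCompact_Icc.exists_bound_of_continuousOn (s := Icc 0 L) hf.continuousOn
    refine MemLp.of_bound hf.aestronglyMeasurable C ?_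
    exact (ae_restrict_iff' measurableSet_Ioo).2
      (Filter.Eventually.of_forall fun x hx => hC x (Ioo_subset_Icc_self hx))
  have hv : Continuous v := continuous_iff_continuousAt.2 fun x => (h x).continuousAt
  refine ⟨hLp v hv, hLp v' hc, fun φ hφs hφc hφt => ?_⟩
  have hφd : HasACDeriv φ (deriv φ) 0 L := HasACDeriv.of_hasDerivAt
    (fun x => (hφs.differentiable (by simp) x).hasDerivAt) (hφs.continuous_deriv (by simp))
  have hφ0 : φ 0 = 0 := image_eq_zero_of_notMem_tsupport fun hx => (hφt hx).1.ne rfl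
  have hφL : φ L = 0 := image_eq_zero_of_notMem_tsupport fun hx => (hφt hx).2.ne rfl
  rw [integral_intervalMeasure hL.le, integral_intervalMeasure hL.le,
    (HasACDeriv.of_hasDerivAt h hc).integral_mul_eq hφd, hφ0, hφL]
  ring

/-- A classical solution of the Neumann problem is a weak solution. -/
theorem IsNeumannSolution.of_hasDerivAt (hL : 0 < L) {a u p : ℝ → ℝ} (ha : Continuous a)
    (hu : ∀ x, HasDerivAt u (p x) x) (hp : ∀ x, HasDerivAt p (-(a x * u x)) x)
    (hp0 : p 0 = 0) (hpL : p L = 0) : IsNeumannSolution L a u := by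
  have hpc : Continuous p := continuous_iff_continuousAt.2 fun x => (hp x).continuousAt
  have huc : Continuous u := continuous_iff_continuousAt.2 fun x => (hu x).continuousAt
  refine ⟨p, MemH1With.of_hasDerivAt hL hu hpc, fun v v' hv => ?_⟩
  obtain ⟨V, hV, hvV⟩ := hv.exists_hasACDeriv hL
  have h1 : ∫ x, a x * u x * v x ∂(intervalMeasure L) =
      ∫ x, a x * u x * V x ∂(intervalMeasure L) :=
    integral_congr_ae (hvV.mono fun x hx => by simp only [hx])
  have hpd : HasACDeriv p (fun x => -(a x * u x)) 0 L :=
    HasACDeriv.of_hasDerivAt hp (ha.mul huc).neg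
  rw [h1, integral_intervalMeasure hL.le, integral_intervalMeasure hL.le,
    hpd.integral_mul_eq hV, hp0, hpL]
  simp only [neg_mul, intervalIntegral.integral_neg]
  ring

/-- A weak solution of the Neumann problem is almost everywhere equal to an absolutely continuous
function with absolutely continuous derivative, which solves the equation and satisfies the
boundary conditions pointwise. -/
theorem IsNeumannSolution.exists_hasACDeriv (hL : 0 < L) {a u : ℝ → ℝ}
    (ha : Integrable a (intervalMeasure L)) (h : IsNeumannSolution L a u) :
    ∃ U P : ℝ → ℝ, HasACDeriv U P 0 L ∧ HasACDeriv P (fun x => -(a x * U x)) 0 L ∧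
      P 0 = 0 ∧ P L = 0 ∧ ∀ᵐ x ∂(intervalMeasure L), u x = U x := by
  obtain ⟨g, hg, hweak⟩ := h
  obtain ⟨U, hU, huU⟩ := hg.exists_hasACDeriv hL
  have haU : IntervalIntegrable (fun x => a x * U x) volume 0 L :=
    ((intervalIntegrable_iff_intervalMeasure hL.le).2 ha).mul_continuousOn hU.continuousOn
  have hQ := HasACDeriv.of_integral haU (left_mem_uIcc (a := 0))
  set Q : ℝ → ℝ := fun x => ∫ t in (0 : ℝ)..x, a t * U t with hQdef
  have hQ0 : Q 0 = 0 := intervalIntegral.integral_same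
  have hweak' : ∀ v v' : ℝ → ℝ, (∀ x, HasDerivAt v (v' x) x) → Continuous v' →
      ∫ x in (0 : ℝ)..L, g x * v' x = ∫ x in (0 : ℝ)..L, v x * (a x * U x) := by
    intro v v' hv hc
    have h1 := hweak v v' (MemH1With.of_hasDerivAt hL hv hc)
    have h2 : ∫ x, a x * u x * v x ∂(intervalMeasure L) =
        ∫ x, v x * (a x * U x) ∂(intervalMeasure L) :=
      integral_congr_ae (huU.mono fun x hx => by simp only [hx]; ring)
    rwa [h2, integral_intervalMeasure hL.le, integral_intervalMeasure hL.le] at h1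
  -- Testing with the constant function `1`.
  have hQL : Q L = 0 := by
    have := hweak' (fun _ => 1) (fun _ => 0) (fun x => hasDerivAt_const x 1) continuous_const
    simpa using this.symm
  -- Testing with primitives of smooth functions.
  have hgi : Integrable g (intervalMeasure L) := hg.memLp_deriv.integrable (by norm_num)
  have hgQ : ∀ᵐ x, x ∈ Ioo 0 L → (Ioo 0 L).indicator (fun x => g x + Q x) x = 0 := by
    refine isOpen_Ioo.ae_eq_zero_of_integral_contDiff_smul_eq_zero ?_ ?_
    · refine IntegrableOn.locallyIntegrableOn (Integrable.integrableOn ?_)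
      refine (integrable_indicator_iff measurableSet_Ioo).2 (hgi.add ?_)
      exact (intervalIntegrable_iff_intervalMeasure hL.le).1 hQ.continuousOn.intervalIntegrable
    · intro ψ hψs hψc hψt
      have hd : ∀ x, HasDerivAt (fun x => ∫ t in (0 : ℝ)..x, ψ t) (ψ x) x := fun x =>
        intervalIntegral.integral_hasDerivAt_right (hψs.continuous.intervalIntegrable _ _)
          hψs.continuous.stronglyMeasurable.stronglyMeasurableAtFilter hψs.continuous.continuousAt
      have h1 := hweak' _ _ hd hψs.continuous
      have h2 := (HasACDeriv.of_hasDerivAt (a := 0) (b := L) hd hψs.continuous).integral_mul_eq hQ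
      have h3 : ∫ x, ψ x • (Ioo 0 L).indicator (fun x => g x + Q x) x =
          ∫ x in (0 : ℝ)..L, (g x * ψ x + ψ x * Q x) := by
        rw [← integral_intervalMeasure hL.le, ← integral_indicator measurableSet_Ioo]
        congr 1; ext x
        by_cases hx : x ∈ Ioo 0 L
        · simp only [indicator_of_mem hx, smul_eq_mul]; ring
        · simp [indicator_of_notMem hx]
      rw [h3, intervalIntegral.integral_add, h1, h2, hQL, hQ0]
      · ring
      · exact ((intervalIntegrable_iff_intervalMeasure hL.le).2 hgi).mul_continuousOn
          hψs.continuous.continuousOn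
      · exact (hψs.continuous.continuousOn.mul hQ.continuousOn).intervalIntegrable
  have hgQ' : ∀ᵐ x, x ∈ uIcc 0 L → g x = -Q x := by
    rw [← ae_intervalMeasure_iff hL.le]
    refine (ae_restrict_iff' measurableSet_Ioo).2 (hgQ.mono fun x hx hxm => ?_)
    have := hx hxm
    rw [indicator_of_mem hxm] at this
    linarith
  exact ⟨U, fun x => -Q x, hU.congr_deriv hgQ', hQ.neg, by simp [hQ0], by simp [hQL], huU⟩

end Sobolev

/-! ### A minimizing family -/

/-- A continuous even periodic nonnegative function of prescribed mass, concentrated in the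
`δ`-neighbourhood of the multiples of the period. -/
theorem exists_periodic_bump {T δ m : ℝ} (hδ : 0 < δ) (hδT : δ < T / 2) (hm : 0 < m) :
    ∃ h : ℝ → ℝ, Continuous h ∧ (∀ x, 0 ≤ h x) ∧ (∀ x, h (-x) = h x) ∧ Function.Periodic h T ∧
      (∀ x ∈ Icc δ (T / 2), h x = 0) ∧ (∀ x ∈ Ico 0 δ, 0 < h x) ∧ ∫ x in (0 : ℝ)..δ, h x = m := by
  have hT : 0 < T := by linarith
  set c := 2 * Real.pi / T with hc
  have hc0 : 0 < c := by positivity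
  have hcT : c * (T / 2) = Real.pi := by rw [hc]; field_simp
  set b : ℝ → ℝ := fun x => max 0 (Real.cos (c * x) - Real.cos (c * δ)) with hb
  have hbc : Continuous b := by fun_prop
  have hb0 : ∀ x, 0 ≤ b x := fun x => le_max_left _ _
  have hbpos : ∀ x ∈ Ico 0 δ, 0 < b x := by
    intro x hx
    refine lt_max_of_lt_right (sub_pos.2 ?_)
    exact Real.cos_lt_cos_of_nonneg_of_le_pi (mul_nonneg hc0.le hx.1) (by nlinarith)
      (mul_lt_mul_of_pos_left hx.2 hc0)
  have hI : 0 < ∫ x in (0 : ℝ)..δ, b x :=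
    intervalIntegral.intervalIntegral_pos_of_pos_on (hbc.intervalIntegrable _ _)
      (fun x hx => hbpos x (Ioo_subset_Ico_self hx)) hδ
  refine ⟨fun x => m / (∫ x in (0 : ℝ)..δ, b x) * b x, by fun_prop, fun x => ?_, fun x => ?_,
    fun x => ?_, fun x hx => ?_, fun x hx => ?_, ?_⟩
  · exact mul_nonneg (by positivity) (hb0 x)
  · simp [hb]
  · have : c * (x + T) = c * x + 2 * Real.pi := by linarith
    simp [hb, this]
  · have : Real.cos (c * x) ≤ Real.cos (c * δ) :=
      Real.cos_le_cos_of_nonneg_of_le_pi (by positivity) (by nlinarith [hx.2])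
        (mul_le_mul_of_nonneg_left hx.1 hc0.le)
    have : b x = 0 := max_eq_left (by linarith)
    simp [this]
  · exact mul_pos (by positivity) (hbpos x hx)
  · rw [intervalIntegral.integral_const_mul, div_mul_cancel₀ _ hI.ne']

/-- A potential prescribed through its Prüfer angle `θ`: if `θ' = k + h` with `h` vanishing
wherever `cos² θ < cos² θc`, then `u = r cos θ` with `r' / r = h tan θ` solves `u'' + a u = 0`
for `a = k² + k h sec² θ`. -/
theorem isNeumannSolution_of_prufer_angle {L k θc : ℝ} {h θ : ℝ → ℝ} (hL : 0 < L)
    (hc : 0 < Real.cos θc) (hhc : Continuous h) (hθ : ∀ x, HasDerivAt θ (k + h x) x)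
    (hh : ∀ x, h x ≠ 0 → Real.cos θc ^ 2 ≤ Real.cos (θ x) ^ 2)
    (hθ0 : Real.sin (θ 0) = 0) (hθL : Real.sin (θ L) = 0) :
    HasNontrivialNeumannSolution L (fun x => k ^ 2 + k * (h x * capSecSq θc (θ x))) := by
  have hθc : Continuous θ := continuous_iff_continuousAt.2 fun x => (hθ x).continuousAt
  have hMc : Continuous fun x => capSecSq θc (θ x) := (continuous_capSecSq hc).comp hθc
  have hhM : ∀ x, h x * (Real.cos (θ x) ^ 2 * capSecSq θc (θ x)) = h x := by
    intro x
    by_cases hx : h x = 0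
    · simp [hx]
    · rw [capSecSq, max_eq_left (hh x hx), mul_inv_cancel₀, mul_one]
      exact (lt_of_lt_of_le (by positivity) (hh x hx)).ne'
  set ρ : ℝ → ℝ := fun x => h x * (Real.sin (θ x) * Real.cos (θ x) * capSecSq θc (θ x)) with hρ
  have hρc : Continuous ρ := by fun_prop
  have hR : ∀ x, HasDerivAt (fun x => Real.exp (∫ t in (0 : ℝ)..x, ρ t))
      (Real.exp (∫ t in (0 : ℝ)..x, ρ t) * ρ x) x := fun x =>
    (intervalIntegral.integral_hasDerivAt_right (hρc.intervalIntegrable _ _)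
      hρc.stronglyMeasurable.stronglyMeasurableAtFilter hρc.continuousAt).exp
  set r : ℝ → ℝ := fun x => Real.exp (∫ t in (0 : ℝ)..x, ρ t)
  have hrc : Continuous r := continuous_iff_continuousAt.2 fun x => (hR x).continuousAt
  refine ⟨fun x => r x * Real.cos (θ x), IsNeumannSolution.of_hasDerivAt hL (by fun_prop)
    (p := fun x => -(k * (r x * Real.sin (θ x)))) (fun x => ?_) (fun x => ?_)
    (by simp [hθ0]) (by simp [hθL]), fun hzero => ?_⟩
  · convert! (hR x).mul ((hθ x).cos) using 1
    simp only [hρ]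
    linear_combination (-(r x * Real.sin (θ x))) * hhM x
  · convert! (((hR x).mul ((hθ x).sin)).const_mul k).neg using 1
    simp only [hρ]
    have h1 := hhM x
    have h2 := Real.sin_sq_add_cos_sq (θ x)
    linear_combination (-(k * r x * Real.cos (θ x))) * h1 +
      (k * r x * h x * Real.cos (θ x) * capSecSq θc (θ x)) * h2
  · have hzero' : (fun x => r x * Real.cos (θ x)) =ᵐ[volume.restrict (Icc 0 L)] fun _ => 0 := by
      rw [← Measure.restrict_congr_set Ioo_ae_eq_Icc]
      exact hzero
    have h0 := Measure.eqOn_Icc_of_ae_eq volume hL.ne hzero' (by fun_prop) continuousOn_const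
      (left_mem_Icc.2 hL.le)
    simp only [mul_eq_zero] at h0
    rcases h0 with h0 | h0
    · exact (Real.exp_pos _).ne' h0
    · have := Real.sin_sq_add_cos_sq (θ 0)
      simp [hθ0, h0] at this

/-- Potentials in `Λ_n` whose distance to `λ_n` is close to the extremal value. Their Prüfer angle
grows at speed `k` except in the `δ`-neighbourhoods of the multiples of `L / (n + 1)`, where it
gains `π / (n + 1)` in addition. -/
theorem exists_mem_LambdaSet_distL1_le {L k δ : ℝ} {n : ℕ} (hL : 0 < L) (hk : 0 < k)
    (hkL : k * L = n * Real.pi) (hδ : 0 < δ) (hδT : δ < L / (n + 1) / 2) :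
    ∃ a ∈ LambdaSet L n,
      distL1 L n a ≤ 2 * k * (n + 1) * Real.tan (Real.pi / (2 * (n + 1)) + k * δ) := by
  have hlam : neumannEigenvalue L n = k ^ 2 := by
    rw [neumannEigenvalue, eq_comm, eq_div_iff (by positivity), ← mul_pow, hkL, mul_pow]
  set T := L / (n + 1) with hT
  have hTL : (n + 1) * T = L := by rw [hT]; field_simp
  set θ₀ := Real.pi / (2 * (n + 1)) with hθ₀
  have hθ₀pos : 0 < θ₀ := by positivity
  have hθ₀mul : 2 * (n + 1) * θ₀ = Real.pi := by rw [hθ₀]; field_simp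
  have hn1 : (0 : ℝ) < n + 1 := by positivity
  have hkT : k * T + 2 * θ₀ = Real.pi := by
    refine mul_left_cancel₀ hn1.ne' ?_
    have : (n + 1) * (k * T) = k * L := by rw [← hTL]; ring
    linarith
  obtain ⟨h, hhc, hh0, hheven, hhper, hhz, hhpos, hhi⟩ := exists_periodic_bump hδ hδT hθ₀pos
  have hhint : ∀ a b, IntervalIntegrable h volume a b := fun a b => hhc.intervalIntegrable a b
  have hhabs : ∀ x, δ ≤ |x| → |x| ≤ T / 2 → h x = 0 := by
    intro x h1 h2
    have : h |x| = h x := by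
      rcases abs_choice x with hx | hx
      · rw [hx]
      · rw [hx, hheven]
    rw [← this]
    exact hhz _ ⟨h1, h2⟩
  set θ : ℝ → ℝ := fun x => k * x + ∫ t in (0 : ℝ)..x, h t with hθdef
  have hθ : ∀ x, HasDerivAt θ (k + h x) x := fun x => by
    convert! ((hasDerivAt_id x).const_mul k).add
      (intervalIntegral.integral_hasDerivAt_right (hhint 0 x)
        hhc.stronglyMeasurable.stronglyMeasurableAtFilter hhc.continuousAt) using 1
    rw [mul_one]
  have hθ0 : θ 0 = 0 := by simp [hθdef]
  have hodd : ∀ x, ∫ t in (0 : ℝ)..(-x), h t = -∫ t in (0 : ℝ)..x, h t := by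
    intro x
    have := intervalIntegral.integral_comp_neg (a := 0) (b := x) h
    simp only [hheven, neg_zero] at this
    rw [this, intervalIntegral.integral_symm]
  have hhalf : ∫ t in (0 : ℝ)..(T / 2), h t = θ₀ := by
    rw [← intervalIntegral.integral_add_adjacent_intervals (hhint 0 δ) (hhint δ (T / 2)), hhi,
      intervalIntegral.integral_congr (g := fun _ => 0) fun x hx => ?_]
    · simp
    · rw [uIcc_of_le hδT.le] at hx
      exact hhz x hx
  have hmass : ∀ x, ∫ t in x..(x + T), h t = 2 * θ₀ := by
    intro x
    rw [hhper.intervalIntegral_add_eq x (-(T / 2)),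
      ← intervalIntegral.integral_interval_sub_left (hhint 0 _) (hhint 0 _), hodd,
      show -(T / 2) + T = T / 2 by ring, hhalf]
    ring
  have hθT : ∀ x, θ (x + T) = θ x + Real.pi := by
    intro x
    simp only [hθdef]
    rw [← intervalIntegral.integral_add_adjacent_intervals (hhint 0 x) (hhint x (x + T)), hmass,
      ← hkT]
    ring
  have hθmul : ∀ m : ℕ, θ (m * T) = m * Real.pi := by
    intro m
    induction m with
    | zero => simp [hθ0]
    | succ m ih =>
      rw [Nat.cast_succ, add_mul, one_mul, hθT, ih]
      ring
  have hθL : θ L = (n + 1 : ℕ) * Real.pi := by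
    rw [← hθmul, ← hTL, Nat.cast_succ]
  have hθδ : θ δ = θ₀ + k * δ := by simp only [hθdef, hhi]; ring
  have hθδ' : θ (-δ) = -(θ₀ + k * δ) := by simp only [hθdef, hodd, hhi]; ring
  set θc := θ₀ + k * δ with hθc
  have hθcpos : 0 < θc := by positivity
  have hθclt : θc < Real.pi / 2 := by nlinarith
  have hc : 0 < Real.cos θc := Real.cos_pos_of_mem_Ioo ⟨by linarith, hθclt⟩
  have hmono : Monotone θ := monotone_of_hasDerivAt_nonneg hθ fun x => by
    have := hh0 x; positivity
  have hθabs : ∀ x, |x| ≤ δ → |θ x| ≤ θc := by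
    intro x hx
    rw [abs_le] at hx ⊢
    exact ⟨hθδ' ▸ hmono hx.1, hθδ ▸ hmono hx.2⟩
  have hcosper : Function.Periodic (fun x => (h x, Real.cos (θ x) ^ 2)) T := fun x => by
    simp [hhper x, hθT, Real.cos_add_pi]
  have hsupp : ∀ x, h x ≠ 0 → Real.cos θc ^ 2 ≤ Real.cos (θ x) ^ 2 := by
    intro x hx
    obtain ⟨y, hy, hxy⟩ := hcosper.exists_mem_Ico (by linarith) x (-(T / 2))
    simp only [Prod.mk.injEq] at hxy
    rw [hxy.1] at hx
    rw [hxy.2, ← Real.cos_abs (θ y)]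
    have hyT : |y| ≤ T / 2 := abs_le.2 ⟨hy.1, by linarith [hy.2]⟩
    have hyδ : |y| ≤ δ := le_of_not_gt fun hgt => hx (hhabs y hgt.le hyT)
    have := Real.cos_le_cos_of_nonneg_of_le_pi (abs_nonneg (θ y)) (by linarith) (hθabs y hyδ)
    gcongr
  have hθcont : Continuous θ := continuous_iff_continuousAt.2 fun x => (hθ x).continuousAt
  have hqc : Continuous fun x => h x * capSecSq θc (θ x) :=
    hhc.mul ((continuous_capSecSq hc).comp hθcont)
  have hq0 : ∀ x, 0 ≤ h x * capSecSq θc (θ x) := fun x =>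
    mul_nonneg (hh0 x) (capSecSq_pos hc _).le
  have hqint : ∀ a b, IntervalIntegrable (fun x => h x * capSecSq θc (θ x)) volume a b :=
    fun a b => hqc.intervalIntegrable a b
  have hqper : Function.Periodic (fun x => h x * capSecSq θc (θ x)) T := fun x => by
    simp only [hhper x, hθT, capSecSq_periodic (θ x)]
  -- Near a multiple of `T` the integral is at most that of `sec² θ · θ'`.
  have hcost : ∫ x in (-δ)..δ, h x * capSecSq θc (θ x) ≤ 2 * Real.tan θc := by
    have hcomp : ∫ x in (-δ)..δ, capSecSq θc (θ x) * (k + h x) = 2 * Real.tan θc := by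
      have := intervalIntegral.integral_comp_mul_deriv (a := -δ) (b := δ) (fun x _ => hθ x)
        (by fun_prop) (continuous_capSecSq hc)
      rwa [hθδ, hθδ', integral_capSecSq_symm hθclt hθcpos.le] at this
    rw [← hcomp]
    refine intervalIntegral.integral_mono_on (by linarith) (hqint _ _)
      ((((continuous_capSecSq hc).comp hθcont).mul
        (continuous_const.add hhc)).intervalIntegrable _ _) fun x _ => ?_
    have := mul_pos (capSecSq_pos hc (θ x)) hk
    linarith
  have hperiod : ∫ x in (0 : ℝ)..(0 + T), h x * capSecSq θc (θ x) ≤ 2 * Real.tan θc := by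
    rw [hqper.intervalIntegral_add_eq 0 (-(T / 2)), show -(T / 2) + T = T / 2 by ring,
      ← intervalIntegral.integral_add_adjacent_intervals (hqint _ (-δ)) (hqint _ _),
      ← intervalIntegral.integral_add_adjacent_intervals (hqint (-δ) δ) (hqint _ _),
      intervalIntegral.integral_congr (a := -(T / 2)) (g := fun _ => 0) fun x hx => ?_,
      intervalIntegral.integral_congr (a := δ) (g := fun _ => 0) fun x hx => ?_]
    · simpa using hcost
    · rw [uIcc_of_le hδT.le] at hx
      simp only [hhz x hx, zero_mul]
    · rw [uIcc_of_le (by linarith)] at hx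
      have hx0 : |x| = -x := abs_of_nonpos (by linarith [hx.2])
      simp only [hhabs x (by linarith [hx.2]) (by linarith [hx.1]), zero_mul]
  have htotal : ∫ x in (0 : ℝ)..L, h x * capSecSq θc (θ x) ≤ (n + 1) * (2 * Real.tan θc) := by
    have := hqper.intervalIntegral_add_zsmul_eq (n + 1 : ℕ) 0 hqint
    simp only [zsmul_eq_mul, zero_add] at this
    rw [zero_add] at hperiod
    push_cast at this
    rw [hTL] at this
    rw [this]
    gcongr
  refine ⟨fun x => k ^ 2 + k * (h x * capSecSq θc (θ x)), ⟨?_, ⟨?_, ?_⟩, ?_⟩, ?_⟩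
  · exact (intervalIntegrable_iff_intervalMeasure hL.le).1
      ((continuous_const.add (continuous_const.mul hqc)).intervalIntegrable _ _)
  · refine Filter.Eventually.of_forall fun x => ?_
    rw [hlam]
    have := mul_nonneg hk.le (hq0 x)
    linarith
  · have hδL : δ ≤ L := by nlinarith
    calc (0 : ENNReal) < volume (Ioo 0 δ) := by simpa using hδ
      _ = intervalMeasure L (Ioo 0 δ) := by
          rw [Measure.restrict_apply measurableSet_Ioo,
            inter_eq_left.2 (Ioo_subset_Ioo_right hδL)]
      _ ≤ _ := measure_mono fun x hx => by
          have := mul_pos hk (mul_pos (hhpos x (Ioo_subset_Ico_self hx)) (capSecSq_pos hc (θ x)))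
          simp only [mem_ofPred_eq, hlam]
          linarith
  · refine isNeumannSolution_of_prufer_angle hL hc hhc hθ hsupp (by simp [hθ0]) ?_
    rw [hθL, Real.sin_nat_mul_pi]
  · rw [distL1, integral_intervalMeasure hL.le]
    have : ∀ x, |k ^ 2 + k * (h x * capSecSq θc (θ x)) - neumannEigenvalue L n| =
        k * (h x * capSecSq θc (θ x)) := fun x => by
      rw [hlam, add_sub_cancel_left, abs_of_nonneg (mul_nonneg hk.le (hq0 x))]
    simp only [this, intervalIntegral.integral_const_mul]
    calc _ ≤ k * ((n + 1) * (2 * Real.tan θc)) := by gcongr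
      _ = _ := by ring

/-! ### The infimum -/

theorem lt_distL1_of_mem_LambdaSet {L k : ℝ} {n : ℕ} {a : ℝ → ℝ} (hL : 0 < L) (hn : 1 ≤ n)
    (hk : 0 < k) (hkL : k * L = n * Real.pi) (ha : a ∈ LambdaSet L n) :
    2 * k * (n + 1) * Real.tan (Real.pi / (2 * (n + 1))) < distL1 L n a := by
  have hlam : neumannEigenvalue L n = k ^ 2 := by
    rw [neumannEigenvalue, eq_comm, eq_div_iff (by positivity), ← mul_pow, hkL, mul_pow]
  obtain ⟨hai, ⟨hle, hpos⟩, u, hu, hune⟩ := ha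
  simp only [hlam] at hle hpos
  obtain ⟨U, P, hU, hP, hP0, hPL, huU⟩ := hu.exists_hasACDeriv hL hai
  have hne : ∃ x ∈ Icc 0 L, U x ≠ 0 := by
    by_contra! hcon
    refine hune ?_
    filter_upwards [huU, ae_restrict_mem measurableSet_Ioo] with x hx hxm
    rw [hx, hcon x (Ioo_subset_Icc_self hxm), Pi.zero_apply]
  have hai' := (intervalIntegrable_iff_intervalMeasure hL.le).2 hai
  obtain ⟨θ, hθ, hθ0, hθL⟩ := exists_prufer_angle hk hL hai' hU hP hP0 hPL hne
  have hle' := (ae_intervalMeasure_iff hL.le).1 hle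
  rw [uIcc_of_le hL.le] at hle'
  have hpos' : 0 < volume (Ioc 0 L ∩ {x | k ^ 2 < a x}) := by
    rw [intervalMeasure, Measure.restrict_congr_set Ioo_ae_eq_Ioc,
      Measure.restrict_apply' measurableSet_Ioc, inter_comm] at hpos
    exact hpos
  have habs : distL1 L n a = ∫ x in (0 : ℝ)..L, (a x - k ^ 2) := by
    rw [distL1, ← integral_intervalMeasure hL.le]
    refine integral_congr_ae (hle.mono fun x hx => ?_)
    simp only [hlam, abs_of_nonneg (sub_nonneg.2 hx)]
  rw [habs]
  exact lt_integral_sub_of_prufer_angle hn hk hL hkL hai' hle' hpos' hθ hθ0 hθL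

theorem theorem1 (L : ℝ) (hL : 0 < L) (n : ℕ) (hn : 1 ≤ n) :
    (LambdaSet L n).Nonempty ∧
    betaOne L n = 2 * Real.pi * n * (n + 1) / L * Real.cot (Real.pi * n / (2 * (n + 1))) ∧
    ¬ ∃ a ∈ LambdaSet L n, distL1 L n a = betaOne L n := by
  have hn' : (1 : ℝ) ≤ n := by exact_mod_cast hn
  set k := n * Real.pi / L with hkdef
  have hk : 0 < k := by positivity
  have hkL : k * L = n * Real.pi := by rw [hkdef]; field_simp
  have hcot : Real.cot (Real.pi * n / (2 * (n + 1))) = Real.tan (Real.pi / (2 * (n + 1))) := by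
    have : Real.pi * n / (2 * (n + 1)) = Real.pi / 2 - Real.pi / (2 * (n + 1)) := by
      field_simp; ring
    rw [this, Real.cot_eq_cos_div_sin, Real.cos_pi_div_two_sub, Real.sin_pi_div_two_sub,
      Real.tan_eq_sin_div_cos]
  have hconst : 2 * Real.pi * n * (n + 1) / L * Real.cot (Real.pi * n / (2 * (n + 1))) =
      2 * k * (n + 1) * Real.tan (Real.pi / (2 * (n + 1))) := by
    rw [hcot, hkdef]; ring
  set T := L / (n + 1) / 2 with hT
  have hTpos : 0 < T := by positivity
  have hlow : ∀ a ∈ LambdaSet L n, 2 * k * (n + 1) * Real.tan (Real.pi / (2 * (n + 1))) <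
      distL1 L n a := fun a ha => lt_distL1_of_mem_LambdaSet hL hn hk hkL ha
  have hne : (LambdaSet L n).Nonempty := by
    obtain ⟨a, ha, -⟩ := exists_mem_LambdaSet_distL1_le hL hk hkL (half_pos hTpos)
      (half_lt_self hTpos)
    exact ⟨a, ha⟩
  have hbeta : betaOne L n = 2 * k * (n + 1) * Real.tan (Real.pi / (2 * (n + 1))) := by
    refine csInf_eq_of_forall_ge_of_forall_gt_exists_lt (hne.image _) ?_ fun w hw => ?_
    · rintro _ ⟨a, ha, rfl⟩
      exact (hlow a ha).le
    · have hcos : Real.cos (Real.pi / (2 * (n + 1)) + k * 0) ≠ 0 := by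
        have h1 : Real.pi / (2 * (n + 1)) < Real.pi / 2 :=
          div_lt_div_of_pos_left Real.pi_pos two_pos (by linarith)
        have h2 : 0 < Real.pi / (2 * ((n : ℝ) + 1)) := by positivity
        rw [mul_zero, add_zero]
        exact (Real.cos_pos_of_mem_Ioo ⟨by linarith, h1⟩).ne'
      have hcont : ContinuousAt
          (fun δ => 2 * k * (n + 1) * Real.tan (Real.pi / (2 * (n + 1)) + k * δ)) 0 :=
        continuousAt_const.mul (ContinuousAt.comp (g := Real.tan)
          (Real.continuousAt_tan.2 hcos) (by fun_prop))
      have hev := Filter.Tendsto.eventually_lt_const (u := w) (by simpa using hw) hcont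
      obtain ⟨δ, hδ, hδ0, hδT⟩ := ((hev.filter_mono nhdsWithin_le_nhds).and
        (Ioo_mem_nhdsGT hTpos)).exists
      obtain ⟨a, ha, hle⟩ := exists_mem_LambdaSet_distL1_le hL hk hkL hδ0 hδT
      exact ⟨_, ⟨a, ha, rfl⟩, hle.trans_lt hδ⟩
  refine ⟨hne, hbeta.trans hconst.symm, ?_⟩
  rintro ⟨a, ha, hd⟩
  exact (hlow a ha).ne' (hd.trans hbeta)
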